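/- Let $\mathcal H$ be a complex Hilbert space, let $A:\mathcal D(A)\subseteq\mathcal H\to\mathcal H$ be a self-adjoint operator with $0\in\rho(A)$, and let $\tau:\mathcal D(A)\to\mathbb C^n$ be linear, surjective, bounded with respect to the graph norm of $A$, and with kernel dense in $\mathcal H$. Put $G_0:=(\tau(-A)^{-1})^*:\mathbb C^n\to\mathcal H$. Let $\mathsf E(\mathbb C^n)$ be the set of pairs $(\Pi,\Theta)$, where $\Pi$ is an orthogonal projector on $\mathbb C^n$ with range $\mathbb C^n_\Pi$ and $\Theta:\mathbb C^n_\Pi\to\mathbb C^n_\Pi$ is a symmetric operator; $\Pi$ also denotes the injection $\mathbb C^n_\Pi\to\mathbb C^n$ and the surjection $\mathbb C^n\to\mathbb C^n_\Pi$. For $(\Pi,\Theta)\in\mathsf E(\mathbb C^n)$ let $A^{\Pi,\Theta}$ be the (well-defined) extension of $A|\ker\tau$ given by $$\mathcal D(A^{\Pi,\Theta})=\{\phi=\phi_0+G_0\xi:\ \phi_0\in\mathcal D(A),\ \xi\in\mathbb C^n_\Pi,\ \Pi\tau\phi_0=\Theta\xi\},\qquad A^{\Pi,\Theta}\phi=A\phi_0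 .$$ For $M\in GL(\mathbb C^n)$ let $A_M^{\Pi,\Theta}$ be the operator defined in the same way with $\tau$ replaced by $\tau_M:=M\tau$. Then for every $M\in GL(\mathbb C^n)$ and $(\Pi,\Theta)\in\mathsf E(\mathbb C^n)$ there is exactly one $(\Pi_M,\Theta_M)\in\mathsf E(\mathbb C^n)$ with $$A_M^{\Pi_M,\Theta_M}=A^{\Pi,\Theta},$$ and it is given by $$\mathbb C^n_{\Pi_M}=(M^*)^{-1}(\mathbb C^n_\Pi),\qquad \Theta_M=\Pi_M M\Theta M^*\Pi_M .$$ Moreover $\alpha(M,(\Pi,\Theta)):=(\Pi_M,\Theta_M)$ is an action of the group $GL(\mathbb C^n)$ on $\mathsf E(\mathbb C^n)$: $\alpha(1,p)=p$ and $\alpha(MN,p)=\alpha(M,\alpha(N,p))$. -/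

import Mathlib

open scoped ComplexConjugate

noncomputable section

namespace KreinExt

/-- The Hilbert space `ℂⁿ` with its standard scalar product. -/
abbrev Cn (n : ℕ) : Type := EuclideanSpace ℂ (Fin n)

section Bundle

variable {n : ℕ}

/-- A point `(Π, Θ)` of the bundle `E(ℂⁿ)` over the set of orthogonal projectors: `Π` is an
orthogonal projector on `ℂⁿ` and `Θ` is a symmetric operator on the range `ℂⁿ_Π` of `Π`. -/
structure Param (n : ℕ) where
  /-- the orthogonal projector `Π` -/
  proj : Cn n →ₗ[ℂ] Cn n
  isStarProjection : IsStarProjection proj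
  /-- the symmetric operator `Θ` -/
  theta : LinearMap.range proj →ₗ[ℂ] LinearMap.range proj
  isSymmetric : ∀ x y, inner ℂ (theta x) y = inner ℂ x (theta y)

/-- The subspace `ℂⁿ_Π`, the range of `Π`. -/
abbrev Param.space (p : Param n) : Submodule ℂ (Cn n) := LinearMap.range p.proj

/-- `Π` read as the injection `ℂⁿ_Π → ℂⁿ`. -/
abbrev Param.inj (p : Param n) : p.space →ₗ[ℂ] Cn n := p.space.subtype

/-- `Π` read as the surjection `ℂⁿ → ℂⁿ_Π`. -/
abbrev Param.surj (p : Param n) : Cn n →ₗ[ℂ] p.space := p.proj.rangeRestrict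

end Bundle

variable {H : Type*} [NormedAddCommGroup H] [InnerProductSpace ℂ H]

/-- `R` is the (bounded, everywhere defined) inverse of `-A + z : D(A) → H`. -/
def IsResolvent (A : H →ₗ.[ℂ] H) (z : ℂ) (R : H →L[ℂ] H) : Prop :=
  (∀ f : H, ∃ h : R f ∈ A.domain, -A ⟨R f, h⟩ + z • R f = f) ∧
    ∀ φ : A.domain, R (-A φ + z • (φ : H)) = φ

/-- The resolvent set `ρ(A)` of an unbounded operator `A`. -/
def rho (A : H →ₗ.[ℂ] H) : Set ℂ := {z | ∃ R : H →L[ℂ] H, IsResolvent A z R}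

/-- The resolvent `(-A + z)⁻¹`, for `z ∈ ρ(A)`. -/
def res (A : H →ₗ.[ℂ] H) (z : ℂ) (hz : z ∈ rho A) : H →L[ℂ] H := hz.choose

theorem isResolvent_res (A : H →ₗ.[ℂ] H) (z : ℂ) (hz : z ∈ rho A) :
    IsResolvent A z (res A z hz) := hz.choose_spec

/-- The resolvent `(-A + z)⁻¹` as a linear map with values in `D(A)`. -/
def resDom (A : H →ₗ.[ℂ] H) (z : ℂ) (hz : z ∈ rho A) : H →ₗ[ℂ] A.domain :=
  (res A z hz : H →ₗ[ℂ] H).codRestrict A.domain fun f => ((isResolvent_res A z hz).1 f).1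

theorem neg_add_resDom (A : H →ₗ.[ℂ] H) (z : ℂ) (hz : z ∈ rho A) (f : H) :
    -A (resDom A z hz f) + z • (resDom A z hz f : H) = f :=
  ((isResolvent_res A z hz).1 f).2

theorem resDom_neg_add (A : H →ₗ.[ℂ] H) (z : ℂ) (hz : z ∈ rho A) (φ : A.domain) :
    resDom A z hz (-A φ + z • (φ : H)) = φ :=
  Subtype.ext ((isResolvent_res A z hz).2 φ)

/-- A surjective linear map `τ : D(A) → ℂⁿ`, bounded with respect to the graph norm of `A`, whose
kernel is dense in `H`. -/
structure TraceMap (A : H →ₗ.[ℂ] H) (n : ℕ) where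
  toLin : A.domain →ₗ[ℂ] Cn n
  bounded : ∃ C : ℝ, ∀ φ : A.domain, ‖toLin φ‖ ≤ C * (‖A φ‖ + ‖(φ : H)‖)
  surjective : Function.Surjective toLin
  dense_ker : Dense (((LinearMap.ker toLin).map A.domain.subtype : Submodule ℂ H) : Set H)

namespace TraceMap

variable {A : H →ₗ.[ℂ] H} {n : ℕ}

/-- The map `τ_M = M τ`, for `M ∈ GL(ℂⁿ)`. -/
def transform (τ : TraceMap A n) (M : LinearMap.GeneralLinearGroup ℂ (Cn n)) : TraceMap A n where
  toLin := (M : Cn n →ₗ[ℂ] Cn n) ∘ₗ τ.toLin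
  bounded := by
    obtain ⟨C, hC⟩ := τ.bounded
    refine ⟨‖LinearMap.toContinuousLinearMap (M : Cn n →ₗ[ℂ] Cn n)‖ * C, fun φ => ?_⟩
    calc ‖(LinearMap.toContinuousLinearMap (M : Cn n →ₗ[ℂ] Cn n)) (τ.toLin φ)‖
        ≤ ‖LinearMap.toContinuousLinearMap (M : Cn n →ₗ[ℂ] Cn n)‖ * ‖τ.toLin φ‖ :=
          ContinuousLinearMap.le_opNorm _ _
      _ ≤ _ := by rw [mul_assoc]; gcongr; exact hC φ
  surjective :=
    (LinearMap.GeneralLinearGroup.generalLinearEquiv ℂ (Cn n) M).surjective.comp τ.surjective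
  dense_ker := by
    have h : LinearMap.ker ((M : Cn n →ₗ[ℂ] Cn n) ∘ₗ τ.toLin) = LinearMap.ker τ.toLin :=
      LinearMap.ker_comp_of_ker_eq_bot _ (LinearMap.ker_eq_bot.2
        (LinearMap.GeneralLinearGroup.generalLinearEquiv ℂ (Cn n) M).injective)
    rw [h]; exact τ.dense_ker

/-- The bounded operator `τ (-A + z)⁻¹ : H → ℂⁿ`. -/
def compRes (τ : TraceMap A n) (z : ℂ) (hz : z ∈ rho A) : H →L[ℂ] Cn n :=
  (τ.toLin ∘ₗ resDom A z hz).mkContinuousOfExistsBound <| by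
    obtain ⟨C, hC⟩ := τ.bounded
    refine ⟨|C| * (‖z‖ * ‖res A z hz‖ + 1 + ‖res A z hz‖), fun f => ?_⟩
    have h1 : ‖(resDom A z hz f : H)‖ ≤ ‖res A z hz‖ * ‖f‖ := (res A z hz).le_opNorm f
    have h2 : A (resDom A z hz f) = z • (resDom A z hz f : H) - f := by
      conv_rhs => rw [← neg_add_resDom A z hz f]
      rw [neg_add_resDom A z hz f]
      nth_rewrite 3 [← neg_add_resDom A z hz f]
      abel
    have h3 : ‖A (resDom A z hz f)‖ ≤ ‖z‖ * (‖res A z hz‖ * ‖f‖) + ‖f‖ := by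
      rw [h2]
      refine (norm_sub_le _ _).trans ?_
      rw [norm_smul]
      gcongr
    calc ‖τ.toLin (resDom A z hz f)‖
        ≤ C * (‖A (resDom A z hz f)‖ + ‖(resDom A z hz f : H)‖) := hC _
      _ ≤ |C| * (‖A (resDom A z hz f)‖ + ‖(resDom A z hz f : H)‖) := by
          gcongr; exact le_abs_self C
      _ ≤ |C| * ((‖z‖ * (‖res A z hz‖ * ‖f‖) + ‖f‖) + ‖res A z hz‖ * ‖f‖) := by gcongr
      _ = _ := by ring

variable [CompleteSpace H]

/-- `G_z = (τ (-A + z̄)⁻¹)^* : ℂⁿ → H`. -/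
def G (τ : TraceMap A n) (z : ℂ) (hz : conj z ∈ rho A) : Cn n →L[ℂ] H :=
  ContinuousLinearMap.adjoint (τ.compRes (conj z) hz)

/-- `G₀ = (τ (-A)⁻¹)^* : ℂⁿ → H`, for `0 ∈ ρ(A)`. -/
def G0 (τ : TraceMap A n) (h0 : (0 : ℂ) ∈ rho A) : Cn n →L[ℂ] H :=
  τ.G 0 (by rwa [map_zero])

/-- The graph of `A^{Π,Θ}`: the pairs `(φ₀ + G₀ ξ, A φ₀)` with `φ₀ ∈ D(A)`, `ξ ∈ ℂⁿ_Π` and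
`Π τ φ₀ = Θ ξ`. -/
def extGraph (τ : TraceMap A n) (h0 : (0 : ℂ) ∈ rho A) (p : Param n) : Submodule ℂ (H × H) where
  carrier := {x | ∃ (φ₀ : A.domain) (ξ : p.space),
    p.surj (τ.toLin φ₀) = p.theta ξ ∧ x = ((φ₀ : H) + τ.G0 h0 ξ, A φ₀)}
  add_mem' := by
    rintro _ _ ⟨φ, ξ, h, rfl⟩ ⟨ψ, ζ, k, rfl⟩
    refine ⟨φ + ψ, ξ + ζ, by rw [map_add, map_add, map_add, h, k], ?_⟩
    ext
    · simp only [Prod.mk_add_mk, Submodule.coe_add, map_add]; abel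
    · simp only [Prod.mk_add_mk, LinearPMap.map_add]
  zero_mem' := ⟨0, 0, by simp, by simp [Prod.ext_iff]⟩
  smul_mem' := by
    rintro c _ ⟨φ, ξ, h, rfl⟩
    refine ⟨c • φ, c • ξ, by rw [map_smul, map_smul, map_smul, h], ?_⟩
    ext
    · simp
    · simp only [Prod.smul_mk, LinearPMap.map_smul]

/-- The operator `A^{Π,Θ} (φ₀ + G₀ ξ) = A φ₀`, defined on the vectors `φ₀ + G₀ ξ` with
`φ₀ ∈ D(A)`, `ξ ∈ ℂⁿ_Π` and `Π τ φ₀ = Θ ξ`. For `A` self-adjoint it is well defined, see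
`graph_extension`. -/
def extension (τ : TraceMap A n) (h0 : (0 : ℂ) ∈ rho A) (p : Param n) : H →ₗ.[ℂ] H :=
  (τ.extGraph h0 p).toLinearPMap

theorem inner_G0 (τ : TraceMap A n) (h0 : (0 : ℂ) ∈ rho A) (ξ : Cn n) (ψ : A.domain) :
    inner ℂ (τ.G0 h0 ξ) (A ψ) = -inner ℂ ξ (τ.toLin ψ) := by
  have h0' : conj (0 : ℂ) ∈ rho A := by rwa [map_zero]
  have h : resDom A (conj (0 : ℂ)) h0' (A ψ) = -ψ := by
    have := resDom_neg_add A (conj (0 : ℂ)) h0' (-ψ)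
    simpa [LinearPMap.map_neg] using this
  have e : τ.compRes (conj (0 : ℂ)) h0' (A ψ) = τ.toLin (resDom A (conj (0 : ℂ)) h0' (A ψ)) := rfl
  rw [G0, G, ContinuousLinearMap.adjoint_inner_left, e, h, map_neg, inner_neg_right]

/-- `R(G₀) ∩ D(A) = {0}`. -/
theorem eq_zero_of_add_G0 (hA : IsSelfAdjoint A) (τ : TraceMap A n) (h0 : (0 : ℂ) ∈ rho A)
    (φ : A.domain) (ξ : Cn n) (h : (φ : H) + τ.G0 h0 ξ = 0) : φ = 0 := by
  have key : A φ = 0 := by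
    refine τ.dense_ker.eq_zero_of_inner_left ℂ ?_
    rintro _ ⟨ψ, hψ, rfl⟩
    have hsym : inner ℂ (A φ) (ψ : H) = inner ℂ (φ : H) (A ψ) := by
      have hf := LinearPMap.adjoint_isFormalAdjoint (T := A) hA.dense_domain
      have hA' : A.adjoint = A := hA
      rw [hA'] at hf
      exact hf φ ψ
    have hk : τ.toLin ψ = 0 := hψ
    have hφ : (φ : H) = -τ.G0 h0 ξ := eq_neg_of_add_eq_zero_left h
    change inner ℂ (A φ) (ψ : H) = 0
    rw [hsym, hφ, inner_neg_left, inner_G0, hk, inner_zero_right, neg_zero, neg_zero]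
  have := resDom_neg_add A 0 h0 φ
  rw [key] at this
  simpa using this.symm

theorem graph_extension (hA : IsSelfAdjoint A) (τ : TraceMap A n) (h0 : (0 : ℂ) ∈ rho A)
    (p : Param n) : (τ.extension h0 p).graph = τ.extGraph h0 p := by
  refine Submodule.toLinearPMap_graph_eq _ ?_
  rintro _ ⟨φ, ξ, -, rfl⟩ hx
  have : φ = 0 := eq_zero_of_add_G0 hA τ h0 φ ξ hx
  simp [this]

end TraceMap

end KreinExt

end

open KreinExt

namespace KreinExt

/-! ### Boundary data as linear relations on `ℂⁿ`. -/

namespace Param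

variable {n : ℕ}

/-! An extension is encoded by the relation `Rel` of its boundary values `(τ φ₀, ξ)`. The
decomposition `φ₀ + G₀ ξ` is unique and `τ` is onto, so the graph determines the relation
(`mem_extGraph_iff`), and the relation determines `(Π, Θ)` (`rel_injective`). Passing from `τ` to `M
τ` turns `G₀` into `G₀ M^*`, so the same vector has boundary values `(M v, (M^*)⁻¹ ξ)` in place of
`(v, ξ)`. By `transform_rel` the relation so obtained is that of `(Π_M, Θ_M)`. The action laws
follow from uniqueness. -/

theorem inner_surj (p : Param n) (v : Cn n) (y : p.space) :
    inner ℂ (p.surj v : Cn n) (y : Cn n) = inner ℂ v (y : Cn n) := by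
  obtain ⟨_, z, rfl⟩ := y
  have hs := LinearMap.isStarProjection_iff_isSymmetricProjection.1 p.isStarProjection
  have hz : p.proj (p.proj z) = p.proj z := congrArg (· z) hs.isIdempotentElem.eq
  change inner ℂ (p.proj v) (p.proj z) = inner ℂ v (p.proj z)
  rw [hs.isSymmetric v (p.proj z), hz]

theorem surj_eq_iff (p : Param n) (v : Cn n) (w : p.space) :
    p.surj v = w ↔ ∀ y : p.space, inner ℂ v (y : Cn n) = inner ℂ (w : Cn n) (y : Cn n) := by
  constructor
  · rintro rfl y
    exact (p.inner_surj v y).symm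
  · intro h
    refine ext_inner_right ℂ fun y => ?_
    rw [Submodule.coe_inner, Submodule.coe_inner, p.inner_surj, h]

theorem surj_coe (p : Param n) (w : p.space) : p.surj w = w :=
  (p.surj_eq_iff w w).2 fun _ => rfl

theorem ext_of_space {p q : Param n} (hspace : p.space = q.space)
    (htheta : ∀ x (hp : x ∈ p.space) (hq : x ∈ q.space),
      (p.theta ⟨x, hp⟩ : Cn n) = q.theta ⟨x, hq⟩) : p = q := by
  obtain ⟨P, hP, S, hS⟩ := p
  obtain ⟨Q, hQ, T, hT⟩ := q
  obtain rfl : P = Q := (LinearMap.IsStarProjection.ext_iff hP hQ).2 hspace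
  obtain rfl : S = T := LinearMap.ext fun x => Subtype.ext (htheta x x.2 x.2)
  rfl

/-- The linear relation `{(v, ξ) : ξ ∈ ℂⁿ_Π, Π v = Θ ξ}` of boundary values. -/
def Rel (p : Param n) (v ξ : Cn n) : Prop :=
  ∃ h : ξ ∈ p.space, p.surj v = p.theta ⟨ξ, h⟩

/-- The second components of the relation fill `ℂⁿ_Π`, and `Θ ξ` is the only `v` in `ℂⁿ_Π` related
to `ξ`. -/
theorem rel_injective {p q : Param n} (h : ∀ v ξ, p.Rel v ξ ↔ q.Rel v ξ) : p = q := by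
  have hmem (r : Param n) (ξ : Cn n) (hξ : ξ ∈ r.space) : r.Rel (r.theta ⟨ξ, hξ⟩) ξ :=
    ⟨hξ, r.surj_coe _⟩
  have hspace : p.space = q.space := by
    ext ξ
    exact ⟨fun hξ => ((h _ _).1 (hmem p ξ hξ)).1, fun hξ => ((h _ _).2 (hmem q ξ hξ)).1⟩
  refine ext_of_space hspace fun x hp hq => ?_
  obtain ⟨_, hx⟩ := (h _ _).1 (hmem p x hp)
  rw [← hx]
  exact congrArg Subtype.val (q.surj_coe ⟨_, hspace ▸ (p.theta ⟨x, hp⟩).2⟩).symm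

/-- The point `(Π_M, Θ_M)`: the projector onto `(M^*)⁻¹ (ℂⁿ_Π)` and the compression of
`M Θ M^*` to its range. -/
noncomputable def transform (M : LinearMap.GeneralLinearGroup ℂ (Cn n)) (p : Param n) : Param n :=
  let P : Cn n →ₗ[ℂ] Cn n :=
    (p.space.comap (LinearMap.adjoint (M : Cn n →ₗ[ℂ] Cn n))).starProjection
  have hP : IsStarProjection P :=
    LinearMap.isStarProjection_toContinuousLinearMap_iff.1 (isStarProjection_starProjection)
  have hrange (x : LinearMap.range P) :
      LinearMap.adjoint (M : Cn n →ₗ[ℂ] Cn n) x ∈ p.space := by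
    have h : LinearMap.range P = p.space.comap (LinearMap.adjoint (M : Cn n →ₗ[ℂ] Cn n)) :=
      Submodule.range_starProjection _
    exact h.le x.2
  { proj := P
    isStarProjection := hP
    theta := P.rangeRestrict ∘ₗ (M : Cn n →ₗ[ℂ] Cn n) ∘ₗ p.inj ∘ₗ p.theta ∘ₗ p.surj ∘ₗ
      LinearMap.adjoint (M : Cn n →ₗ[ℂ] Cn n) ∘ₗ (LinearMap.range P).subtype
    isSymmetric := fun x y => by
      -- The form of `Θ_M` is that of `Θ` pulled back along `M^*`, hence symmetric.
      have key (x y : LinearMap.range P) :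
          inner ℂ (P.rangeRestrict ((M : Cn n →ₗ[ℂ] Cn n) (p.theta (p.surj
            (LinearMap.adjoint (M : Cn n →ₗ[ℂ] Cn n) x))))) y =
          inner ℂ (p.theta ⟨_, hrange x⟩) ⟨_, hrange y⟩ := by
        have h := inner_surj ⟨P, hP, 0, by simp⟩
          ((M : Cn n →ₗ[ℂ] Cn n) (p.theta ⟨_, hrange x⟩)) y
        rw [p.surj_coe ⟨_, hrange x⟩, Submodule.coe_inner, Submodule.coe_inner,
          LinearMap.adjoint_inner_right]
        exact h
      change inner ℂ (P.rangeRestrict ((M : Cn n →ₗ[ℂ] Cn n) (p.theta (p.surj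
            (LinearMap.adjoint (M : Cn n →ₗ[ℂ] Cn n) x))))) y =
        inner ℂ x (P.rangeRestrict ((M : Cn n →ₗ[ℂ] Cn n) (p.theta (p.surj
            (LinearMap.adjoint (M : Cn n →ₗ[ℂ] Cn n) y)))))
      rw [key x y, ← inner_conj_symm (𝕜 := ℂ) x (P.rangeRestrict _), key y x, p.isSymmetric]
      exact (inner_conj_symm (𝕜 := ℂ) (E := p.space) _ _).symm }

theorem transform_space (M : LinearMap.GeneralLinearGroup ℂ (Cn n)) (p : Param n) :
    (p.transform M).space = p.space.comap (LinearMap.adjoint (M : Cn n →ₗ[ℂ] Cn n)) :=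
  Submodule.range_starProjection _

theorem transform_theta (M : LinearMap.GeneralLinearGroup ℂ (Cn n)) (p : Param n) :
    (p.transform M).theta =
      (p.transform M).surj ∘ₗ (M : Cn n →ₗ[ℂ] Cn n) ∘ₗ p.inj ∘ₗ p.theta ∘ₗ p.surj ∘ₗ
        LinearMap.adjoint (M : Cn n →ₗ[ℂ] Cn n) ∘ₗ (p.transform M).inj :=
  rfl

theorem adjoint_bijective (M : LinearMap.GeneralLinearGroup ℂ (Cn n)) :
    Function.Bijective (LinearMap.adjoint (M : Cn n →ₗ[ℂ] Cn n)) := by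
  have h : IsUnit (LinearMap.adjoint (M : Cn n →ₗ[ℂ] Cn n)) := M.isUnit.star
  exact (Module.End.isUnit_iff _).1 h

/-- Pair both sides with `y` in the new space and move `M` across: this tests `v` and `Θ M^* η`
against `M^* y`, which runs through all of `ℂⁿ_Π` because `M^*` is onto. -/
theorem transform_rel (M : LinearMap.GeneralLinearGroup ℂ (Cn n)) (p : Param n) (v η : Cn n) :
    (p.transform M).Rel ((M : Cn n →ₗ[ℂ] Cn n) v) η ↔
      p.Rel v (LinearMap.adjoint (M : Cn n →ₗ[ℂ] Cn n) η) := by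
  have hmem (y : Cn n) : y ∈ (p.transform M).space ↔
      LinearMap.adjoint (M : Cn n →ₗ[ℂ] Cn n) y ∈ p.space := by
    rw [transform_space, Submodule.mem_comap]
  suffices h : ∀ hη hη', (p.transform M).surj ((M : Cn n →ₗ[ℂ] Cn n) v) =
      (p.transform M).theta ⟨η, hη⟩ ↔ p.surj v = p.theta ⟨_, hη'⟩ from
    ⟨fun ⟨hη, e⟩ => ⟨(hmem η).1 hη, (h _ _).1 e⟩, fun ⟨hη', e⟩ => ⟨(hmem η).2 hη', (h _ _).2 e⟩⟩
  intro hη hη'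
  have ht (y : (p.transform M).space) :
      inner ℂ ((p.transform M).theta ⟨η, hη⟩ : Cn n) (y : Cn n) =
        inner ℂ (p.theta ⟨_, hη'⟩ : Cn n) (LinearMap.adjoint (M : Cn n →ₗ[ℂ] Cn n) y) := by
    have h := (p.transform M).inner_surj ((M : Cn n →ₗ[ℂ] Cn n) (p.theta ⟨_, hη'⟩)) y
    rw [LinearMap.adjoint_inner_right, ← h, transform_theta]
    simp only [LinearMap.comp_apply, Submodule.subtype_apply]
    rw [p.surj_coe ⟨_, hη'⟩]
  rw [surj_eq_iff, surj_eq_iff]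
  constructor
  · rintro h ⟨z, hz⟩
    obtain ⟨y, rfl⟩ := (adjoint_bijective M).2 z
    have := h ⟨y, (hmem y).2 hz⟩
    rwa [ht, ← LinearMap.adjoint_inner_right] at this
  · intro h y
    rw [ht, ← LinearMap.adjoint_inner_right]
    exact h ⟨_, (hmem y).1 y.2⟩

end Param

/-! ### Extensions under a change of trace map. -/

namespace TraceMap

variable {H : Type*} [NormedAddCommGroup H] [InnerProductSpace ℂ H]
variable {A : H →ₗ.[ℂ] H} {n : ℕ}

theorem toLin_injective : Function.Injective (TraceMap.toLin : TraceMap A n → _) := by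
  rintro ⟨_, _, _, _⟩ ⟨_, _, _, _⟩ rfl
  rfl

theorem transform_one (τ : TraceMap A n) : τ.transform 1 = τ :=
  toLin_injective rfl

theorem transform_mul (τ : TraceMap A n) (M N : LinearMap.GeneralLinearGroup ℂ (Cn n)) :
    τ.transform (M * N) = (τ.transform N).transform M :=
  toLin_injective rfl

variable [CompleteSpace H]

theorem G0_transform (τ : TraceMap A n) (h0 : (0 : ℂ) ∈ rho A)
    (M : LinearMap.GeneralLinearGroup ℂ (Cn n)) (ξ : Cn n) :
    (τ.transform M).G0 h0 ξ = τ.G0 h0 (LinearMap.adjoint (M : Cn n →ₗ[ℂ] Cn n) ξ) := by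
  refine ext_inner_right ℂ fun x => ?_
  rw [G0, G0, G, G, ContinuousLinearMap.adjoint_inner_left,
    ContinuousLinearMap.adjoint_inner_left, LinearMap.adjoint_inner_left]
  rfl

theorem G0_injective (τ : TraceMap A n) (h0 : (0 : ℂ) ∈ rho A) :
    Function.Injective (τ.G0 h0) := by
  refine (injective_iff_map_eq_zero _).2 fun ξ hξ => ?_
  obtain ⟨ψ, hψ⟩ := τ.surjective ξ
  have h := τ.inner_G0 h0 ξ ψ
  rw [hξ, inner_zero_left, hψ, eq_comm, neg_eq_zero] at h
  exact inner_self_eq_zero.1 h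

/-- Two decompositions of one vector agree: their `D(A)` parts by `eq_zero_of_add_G0`, then their
`ξ` by injectivity of `G₀`. -/
theorem mem_extGraph_iff (hA : IsSelfAdjoint A) (τ : TraceMap A n) (h0 : (0 : ℂ) ∈ rho A)
    (p : Param n) (φ : A.domain) (ξ : Cn n) :
    ((φ : H) + τ.G0 h0 ξ, A φ) ∈ τ.extGraph h0 p ↔ p.Rel (τ.toLin φ) ξ := by
  constructor
  · rintro ⟨ψ, ζ, h, he⟩
    obtain ⟨he, -⟩ := Prod.ext_iff.1 he
    have hφ : φ - ψ = 0 := by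
      refine eq_zero_of_add_G0 hA τ h0 (φ - ψ) (ξ - ζ) ?_
      rw [Submodule.coe_sub, map_sub, ← sub_eq_zero.2 he, sub_add_sub_comm]
    obtain rfl := sub_eq_zero.1 hφ
    obtain rfl := G0_injective τ h0 (add_left_cancel he)
    exact ⟨ζ.2, h⟩
  · rintro ⟨hξ, h⟩
    exact ⟨φ, ⟨ξ, hξ⟩, h, rfl⟩

theorem extension_eq_iff (hA : IsSelfAdjoint A) (σ τ : TraceMap A n) (h0 : (0 : ℂ) ∈ rho A)
    (p q : Param n) : σ.extension h0 q = τ.extension h0 p ↔ σ.extGraph h0 q = τ.extGraph h0 p := by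
  rw [← graph_extension hA, ← graph_extension hA]
  exact ⟨congrArg _, LinearPMap.eq_of_eq_graph⟩

theorem extGraph_injective (hA : IsSelfAdjoint A) (τ : TraceMap A n) (h0 : (0 : ℂ) ∈ rho A) :
    Function.Injective (τ.extGraph h0) := by
  intro p q h
  refine Param.rel_injective fun v ξ => ?_
  obtain ⟨φ, rfl⟩ := τ.surjective v
  rw [← mem_extGraph_iff hA τ h0, ← mem_extGraph_iff hA τ h0, h]

theorem extGraph_transform (hA : IsSelfAdjoint A) (τ : TraceMap A n) (h0 : (0 : ℂ) ∈ rho A)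
    (M : LinearMap.GeneralLinearGroup ℂ (Cn n)) (p : Param n) :
    (τ.transform M).extGraph h0 (p.transform M) = τ.extGraph h0 p := by
  have key (φ : A.domain) (η : Cn n) :
      ((φ : H) + (τ.transform M).G0 h0 η, A φ) ∈
          (τ.transform M).extGraph h0 (p.transform M) ↔
        ((φ : H) + (τ.transform M).G0 h0 η, A φ) ∈ τ.extGraph h0 p := by
    rw [mem_extGraph_iff hA, G0_transform, mem_extGraph_iff hA]
    exact p.transform_rel M _ _
  ext x
  constructor
  · intro hx
    obtain ⟨φ, η, -, rfl⟩ := id hx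
    exact (key φ η).1 hx
  · intro hx
    obtain ⟨φ, ξ, -, rfl⟩ := id hx
    -- Writing `ξ = M^* η` gives `G₀ ξ` the form required by `key`.
    obtain ⟨η, hη⟩ := (Param.adjoint_bijective M).2 (ξ : Cn n)
    rw [← hη, ← G0_transform] at hx ⊢
    exact (key φ η).2 hx

theorem extension_transform_eq_iff (hA : IsSelfAdjoint A) (τ : TraceMap A n)
    (h0 : (0 : ℂ) ∈ rho A) (M : LinearMap.GeneralLinearGroup ℂ (Cn n)) (p q : Param n) :
    (τ.transform M).extension h0 q = τ.extension h0 p ↔ q = p.transform M := by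
  rw [extension_eq_iff hA, ← extGraph_transform hA τ h0 M p]
  exact (extGraph_injective hA _ h0).eq_iff

end TraceMap

end KreinExt

theorem lemma4p1 {H : Type*} [NormedAddCommGroup H] [InnerProductSpace ℂ H] [CompleteSpace H]
    (A : H →ₗ.[ℂ] H) (hA : IsSelfAdjoint A) (h0 : (0 : ℂ) ∈ rho A)
    (n : ℕ) (τ : TraceMap A n) :
    ∃ α : LinearMap.GeneralLinearGroup ℂ (Cn n) → Param n → Param n,
      -- `α M (Π, Θ) = (Π_M, Θ_M)` is the one point of the bundle that gives the same extension
      (∀ M p q, (τ.transform M).extension h0 q = τ.extension h0 p ↔ q = α M p) ∧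
      -- `ℂⁿ_{Π_M} = (M^*)⁻¹ (ℂⁿ_Π)`
      (∀ M p, (α M p).space =
        p.space.comap (LinearMap.adjoint (M : Cn n →ₗ[ℂ] Cn n))) ∧
      -- `Θ_M = Π_M M Θ M^* Π_M`
      (∀ M p, (α M p).theta =
        (α M p).surj ∘ₗ (M : Cn n →ₗ[ℂ] Cn n) ∘ₗ p.inj ∘ₗ p.theta ∘ₗ p.surj ∘ₗ
          LinearMap.adjoint (M : Cn n →ₗ[ℂ] Cn n) ∘ₗ (α M p).inj) ∧
      -- `α` is an action of the group `GL(ℂⁿ)`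
      (∀ p, α 1 p = p) ∧
      (∀ M N p, α (M * N) p = α M (α N p)) := by
  have key (σ : TraceMap A n) (M p q) := σ.extension_transform_eq_iff hA h0 M p q
  refine ⟨Param.transform, key τ, Param.transform_space, Param.transform_theta,
    fun p => ?_, fun M N p => ?_⟩
  · exact ((key τ 1 p p).1 (by rw [τ.transform_one])).symm
  · refine ((key τ (M * N) p _).1 ?_).symm
    -- As `τ_{MN} = (τ_N)_M`, transforming by `N` and then by `M` keeps the extension, so uniqueness
    -- for `MN` applies.
    rw [τ.transform_mul, (key (τ.transform N) M _ _).2 rfl, (key τ N p _).2 rfl]
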